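/- Let $n\ge 1$, let $x_{jk}$ ($1\le j,k\le 2n$) be the entry coordinates on the space of real $2n\times 2n$ matrices, let $\Delta=\det$, and let $$\tilde\omega=\sum_{j=1}^{2n}\sum_{i=1}^{n}\bigl(x_{j,2i-1}\,dx_{j,2i}-x_{j,2i}\,dx_{j,2i-1}\bigr).$$ Let $\omega$ be the pullback of $\tilde\omega$ to $SL(2n,\mathbb R)=\{\Delta=1\}$ under the inclusion. A contact form on a manifold of dimension $2p+1$ is a smooth $1$-form $\alpha$ whose Cartan class is $2p+1$ at every point $x$, where the Cartan class of $\alpha$ at $x$ is the codimension in the tangent space at $x$ of the characteristic space $\{X : \alpha(X)=0,\ i(X)d\alpha=0\}$. Then: 1. $\omega$ is a contact form on $SL(2n,\mathbb R)$. 2. There is a constant $c\neq 0$, depending only on $n$, such that on the space of $2n\times 2n$ matrices $$\tilde\omega\wedge(d\tilde\omega)^{2n^2-1}\wedge d\Delta=c\,\Delta\;dx_{11}\wedge dx_{12}\wedge\cdots\wedge dx_{2n,2n}.$$ 3. $\omega$ is invariant under left translations by the elements of $SO(2n,\mathbb R)=\{M\in SL(2n,\mathbb R): {}^tM M=I\}$.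 4. $SO(2n,\mathbb R)$ is a maximal compact subgroup of $SL(2n,\mathbb R)$: it is compact, and every compact subgroup containing it equals it. 5. If $n\ge 2$, no left-invariant $1$-form on $SL(2n,\mathbb R)$ is a contact form. -/

import Mathlib

open scoped ContDiff Topology Nat

noncomputable section

namespace SLForms

/-- The vector space of real `m × m` matrices. -/
abbrev Mat (m : ℕ) : Type := Matrix (Fin m) (Fin m) ℝ

/-- Spaces of matrices are normed by the sup norm of the entries; they are finite dimensional, so
that derivatives and smoothness do not depend on this choice. The topology is the usual one. -/
instance instNormedAddCommGroupMat (m : ℕ) : NormedAddCommGroup (Mat m) :=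
  { (inferInstance : AddCommGroup (Mat m)),
    (Matrix.seminormedAddCommGroup (m := Fin m) (n := Fin m)
      (α := ℝ)).toPseudoMetricSpace.replaceTopology rfl with
    norm := fun X => ‖fun i j => X i j‖
    dist_eq := (Matrix.normedAddCommGroup (m := Fin m) (n := Fin m) (α := ℝ)).dist_eq
    eq_of_dist_eq_zero :=
      (Matrix.normedAddCommGroup (m := Fin m) (n := Fin m) (α := ℝ)).eq_of_dist_eq_zero }

instance instNormedSpaceMat (m : ℕ) : NormedSpace ℝ (Mat m) :=
  { (inferInstance : Module ℝ (Mat m)) with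
    norm_smul_le :=
      (Matrix.normedSpace (m := Fin m) (n := Fin m) (α := ℝ) (R := ℝ)).norm_smul_le }

/-- The group `SL(m, ℝ)`, the level set `det = 1` in the space of matrices. -/
abbrev SL (m : ℕ) : Type := Matrix.SpecialLinearGroup (Fin m) ℝ

/-! ### Smoothness of the determinant and the tangent spaces of `SL(m, ℝ)` -/

theorem contDiff_det (m : ℕ) : ContDiff ℝ ∞ (Matrix.det : Mat m → ℝ) := by
  have h : (Matrix.det : Mat m → ℝ) =
      fun X => ∑ s : Equiv.Perm (Fin m), ((Equiv.Perm.sign s : ℤ) : ℝ) * ∏ i, X (s i) i := by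
    funext X
    exact Matrix.det_apply' X
  have he : ∀ i j : Fin m, ContDiff ℝ ∞ (fun X : Mat m => X i j) := fun i j =>
    (LinearMap.toContinuousLinearMap (Matrix.entryLinearMap ℝ ℝ i j)).contDiff
  rw [h]
  exact ContDiff.sum fun s _ => contDiff_const.mul (contDiff_prod fun i _ => he _ _)

theorem differentiableAt_det {m : ℕ} (X : Mat m) :
    DifferentiableAt ℝ (Matrix.det : Mat m → ℝ) X :=
  (contDiff_det m).differentiable (by simp) X

/-- The tangent space of `SL(m, ℝ)` at `g`, realized in the space of matrices as the kernel of the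
differential of the determinant. -/
abbrev tangentSpace {m : ℕ} (g : SL m) : Submodule ℝ (Mat m) :=
  LinearMap.ker (fderiv ℝ (Matrix.det : Mat m → ℝ) (g : Mat m)).toLinearMap

/-- Left multiplication by a matrix, as a continuous linear map. -/
def mulLeftL {m : ℕ} (A : Mat m) : Mat m →L[ℝ] Mat m :=
  LinearMap.toContinuousLinearMap (LinearMap.mulLeft ℝ A)

@[simp] theorem mulLeftL_apply {m : ℕ} (A V : Mat m) : mulLeftL A V = A * V := rfl

theorem mul_mem_tangentSpace {m : ℕ} (h g : SL m) {V : Mat m} (hV : V ∈ tangentSpace g) :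
    (h : Mat m) * V ∈ tangentSpace (h * g) := by
  have e : (fun X : Mat m => (mulLeftL (h : Mat m) X).det) = (Matrix.det : Mat m → ℝ) := by
    funext X
    simp
  have h1 : fderiv ℝ (fun X : Mat m => (mulLeftL (h : Mat m) X).det) (g : Mat m) =
      (fderiv ℝ (Matrix.det : Mat m → ℝ) (mulLeftL (h : Mat m) (g : Mat m))).comp
        (mulLeftL (h : Mat m)) :=
    ((differentiableAt_det _).hasFDerivAt.comp (g : Mat m)
      (mulLeftL (h : Mat m)).hasFDerivAt).fderiv
  rw [e] at h1
  have h2 := congrArg (fun L => L V) h1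
  have h3 : fderiv ℝ (Matrix.det : Mat m → ℝ) (g : Mat m) V = 0 := hV
  simp only [ContinuousLinearMap.comp_apply, mulLeftL_apply, h3] at h2
  change fderiv ℝ (Matrix.det : Mat m → ℝ) ((h * g : SL m) : Mat m) ((h : Mat m) * V) = 0
  rw [Matrix.SpecialLinearGroup.coe_mul]
  exact h2.symm

/-- The differential at `g` of the left translation `x ↦ h * x` of `SL(m, ℝ)`. -/
def leftTranslation {m : ℕ} (h g : SL m) : tangentSpace g →ₗ[ℝ] tangentSpace (h * g) :=
  (LinearMap.mulLeft ℝ (h : Mat m)).restrict fun _ hV => mul_mem_tangentSpace h g hV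

/-! ### Differential forms on `SL(m, ℝ)` -/

/-- Differential `k`-forms on `SL(m, ℝ)` (with no regularity condition). -/
abbrev Form (m k : ℕ) : Type := (g : SL m) → tangentSpace g [⋀^Fin k]→L[ℝ] ℝ

/-- The pullback to `SL(m, ℝ)`, along the inclusion, of a form on the space of matrices. -/
def pullback {m k : ℕ} (η : Mat m → Mat m [⋀^Fin k]→L[ℝ] ℝ) : Form m k :=
  fun g => (η g).compContinuousLinearMap (tangentSpace g).subtypeL

/-- `η` is a smooth form on a neighbourhood of `g` in the space of matrices, whose pullback
agrees with `α` on a neighbourhood of `g` in `SL(m, ℝ)`. -/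
def IsLocalExtension {m k : ℕ} (α : Form m k) (g : SL m)
    (η : Mat m → Mat m [⋀^Fin k]→L[ℝ] ℝ) : Prop :=
  ∃ U : Set (Mat m), IsOpen U ∧ (g : Mat m) ∈ U ∧ ContDiffOn ℝ ∞ η U ∧
    ∀ h : SL m, (h : Mat m) ∈ U → α h = pullback η h

/-- Smooth differential forms on the embedded submanifold `SL(m, ℝ)`. -/
def IsSmooth {m k : ℕ} (α : Form m k) : Prop :=
  ∀ g : SL m, ∃ η, IsLocalExtension α g η

open Classical in
/-- The exterior derivative on `SL(m, ℝ)`: locally, the pullback of the exterior derivative of a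
smooth extension. It does not depend on the extension, see `d_eq`. -/
def d {m k : ℕ} (α : Form m k) : Form m (k + 1) := fun g =>
  if h : ∃ η, IsLocalExtension α g η then pullback (extDeriv h.choose) g else 0

/-- The retraction `X ↦ (det X)^(-1/m) X` of `{det > 0}` onto `SL(m, ℝ)`. -/
def retr (m : ℕ) (X : Mat m) : Mat m := (X.det ^ (-(1 / (m : ℝ)))) • X

theorem pullback_extDeriv_eq_zero {m k : ℕ} (g : SL m)
    (η : Mat m → Mat m [⋀^Fin k]→L[ℝ] ℝ) (U : Set (Mat m)) (hU : IsOpen U)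
    (hg : (g : Mat m) ∈ U) (hη : ContDiffOn ℝ ∞ η U)
    (h0 : ∀ h : SL m, (h : Mat m) ∈ U → pullback η h = 0) :
    pullback (extDeriv η) g = 0 := by
  rcases Nat.eq_zero_or_pos m with rfl | hm
  · ext v
    exact ContinuousAlternatingMap.map_coord_zero _ 0 (Subsingleton.elim _ _)
  have hm0 : (m : ℝ) ≠ 0 := by positivity
  have hgdet : (g : Mat m).det = 1 := g.2
  have hc : ∀ X : Mat m, 0 < X.det →
      ContDiffAt ℝ ∞ (fun X : Mat m => X.det ^ (-(1 / (m : ℝ)))) X := fun X hX =>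
    ((contDiff_det m).contDiffAt).rpow_const_of_ne hX.ne'
  have hr : ∀ X : Mat m, 0 < X.det → ContDiffAt ℝ ∞ (retr m) X := fun X hX =>
    (hc X hX).smul contDiffAt_id
  have hrdet : ∀ X : Mat m, 0 < X.det → (retr m X).det = 1 := by
    intro X hX
    rw [retr, Matrix.det_smul, Fintype.card_fin, ← Real.rpow_natCast, ← Real.rpow_mul hX.le]
    have : -(1 / (m : ℝ)) * m = -1 := by field_simp
    rw [this, Real.rpow_neg_one, inv_mul_cancel₀ hX.ne']
  have hrg : retr m (g : Mat m) = g := by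
    rw [retr, hgdet, Real.one_rpow, one_smul]
  have hpos : ∀ᶠ X in 𝓝 (g : Mat m), 0 < X.det :=
    (contDiff_det m).continuous.continuousAt.eventually (lt_mem_nhds (by rw [hgdet]; norm_num))
  have hrgc : ContDiffAt ℝ ∞ (retr m) (g : Mat m) := hr _ (by rw [hgdet]; norm_num)
  have hmem : ∀ᶠ X in 𝓝 (g : Mat m), retr m X ∈ U :=
    hrgc.continuousAt.eventually (by rw [hrg]; exact hU.mem_nhds hg)
  -- the differential of the retraction takes its values in the tangent spaces
  have htan : ∀ᶠ X in 𝓝 (g : Mat m), ∀ V,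
      fderiv ℝ (Matrix.det : Mat m → ℝ) (retr m X) (fderiv ℝ (retr m) X V) = 0 := by
    filter_upwards [hpos.eventually_nhds] with X hX V
    have h1 : (fun Y => (retr m Y).det) =ᶠ[𝓝 X] fun _ => (1 : ℝ) := by
      filter_upwards [hX] with Y hY using hrdet Y hY
    have h2 : fderiv ℝ (fun Y => (retr m Y).det) X =
        (fderiv ℝ (Matrix.det : Mat m → ℝ) (retr m X)).comp (fderiv ℝ (retr m) X) :=
      ((differentiableAt_det _).hasFDerivAt.comp X
        ((hr X hX.self_of_nhds).differentiableAt (by simp)).hasFDerivAt).fderiv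
    rw [h1.fderiv_eq] at h2
    have h3 := congrArg (fun L => L V) h2
    simpa using h3.symm
  have hzero : (fun X => (η (retr m X)).compContinuousLinearMap (fderiv ℝ (retr m) X))
      =ᶠ[𝓝 (g : Mat m)] fun _ => 0 := by
    filter_upwards [hpos, hmem, htan] with X hX hXU hXt
    ext v
    have h1 := h0 ⟨retr m X, hrdet X hX⟩ hXU
    have h2 := congrArg (fun L => L fun i => ⟨fderiv ℝ (retr m) X (v i), hXt (v i)⟩) h1
    exact h2
  have hd : DifferentiableAt ℝ η (retr m (g : Mat m)) := by
    rw [hrg]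
    exact (hη.contDiffAt (hU.mem_nhds hg)).differentiableAt (by simp)
  have hpb := extDeriv_pullback hd hrgc (by
    rw [minSmoothness_of_isRCLikeNormedField]; exact WithTop.coe_le_coe.mpr le_top)
  rw [hzero.extDeriv_eq, hrg] at hpb
  have hz : extDeriv (fun _ : Mat m => (0 : Mat m [⋀^Fin k]→L[ℝ] ℝ)) (g : Mat m) = 0 := by
    ext v
    rw [extDeriv_apply (differentiableAt_const _)]
    simp
  rw [hz] at hpb
  -- the differential of the retraction is the identity on the tangent space
  have hid : ∀ V ∈ tangentSpace g, fderiv ℝ (retr m) (g : Mat m) V = V := by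
    intro V hV
    have hV' : fderiv ℝ (Matrix.det : Mat m → ℝ) (g : Mat m) V = 0 := hV
    have h1 := (((differentiableAt_det (g : Mat m)).hasFDerivAt.rpow_const
      (p := -(1 / (m : ℝ))) (Or.inl (by rw [hgdet]; norm_num))).smul
        (hasFDerivAt_id (𝕜 := ℝ) (g : Mat m)))
    have h2 : fderiv ℝ (retr m) (g : Mat m) = _ := h1.fderiv
    rw [h2]
    simp [hV', hgdet]
  ext v
  have h1 := congrArg (fun L => L fun i => (v i : Mat m)) hpb
  simp only [ContinuousAlternatingMap.compContinuousLinearMap_apply] at h1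
  rw [show (fderiv ℝ (retr m) (g : Mat m) ∘ fun i => (v i : Mat m)) = fun i => (v i : Mat m) from
    funext fun i => hid _ (v i).2] at h1
  exact h1.symm

/-- The exterior derivative can be computed with any local smooth extension. -/
theorem d_eq {m k : ℕ} {α : Form m k} {g : SL m} {η : Mat m → Mat m [⋀^Fin k]→L[ℝ] ℝ}
    (h : IsLocalExtension α g η) : d α g = pullback (extDeriv η) g := by
  have hex : ∃ η, IsLocalExtension α g η := ⟨η, h⟩
  rw [d, dif_pos hex]
  obtain ⟨U, hU, hgU, hsU, haU⟩ := hex.choose_spec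
  obtain ⟨W, hW, hgW, hsW, haW⟩ := h
  have key := pullback_extDeriv_eq_zero g (hex.choose - η) (U ∩ W) (hU.inter hW) ⟨hgU, hgW⟩
    ((hsU.mono Set.inter_subset_left).sub (hsW.mono Set.inter_subset_right)) (by
      intro x hx
      ext v
      have e := congrArg (fun L => L v) ((haU x hx.1).symm.trans (haW x hx.2))
      exact sub_eq_zero.mpr e)
  have hdU := (hsU.contDiffAt (hU.mem_nhds hgU)).differentiableAt (by simp)
  have hdW := (hsW.contDiffAt (hW.mem_nhds hgW)).differentiableAt (by simp)
  have e : extDeriv (hex.choose - η) (g : Mat m) =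
      extDeriv hex.choose (g : Mat m) - extDeriv η (g : Mat m) := by
    rw [sub_eq_add_neg, extDeriv_add hdU hdW.neg, sub_eq_add_neg]
    congr 1
    have := extDeriv_smul (x := (g : Mat m)) (-1 : ℝ) η
    simpa using this
  ext v
  have h1 := congrArg (fun L => L v) key
  have h2 : (extDeriv (hex.choose - η) (g : Mat m)) (fun i => (v i : Mat m)) = 0 := h1
  rw [e] at h2
  exact sub_eq_zero.mp h2

/-! ### Cartan class, contact forms, invariance -/

/-- The characteristic space at `g` of a form `θ` of positive degree: the tangent vectors `X` with
`i(X) θ = 0` and `i(X) dθ = 0`. -/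
def characteristicSpace {m k : ℕ} (θ : Form m (k + 1)) (g : SL m) :
    Submodule ℝ (tangentSpace g) :=
  LinearMap.ker (θ g).curryLeft.toLinearMap ⊓ LinearMap.ker (d θ g).curryLeft.toLinearMap

/-- The Cartan class at `g`: the codimension of the characteristic space. -/
def cartanClass {m k : ℕ} (θ : Form m (k + 1)) (g : SL m) : ℕ :=
  Module.finrank ℝ (tangentSpace g ⧸ characteristicSpace θ g)

/-- A contact form on `SL(m, ℝ)`: the manifold has odd dimension `2p + 1`, and `α` is a smooth
`1`-form of Cartan class `2p + 1` at every point. -/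
def IsContactForm {m : ℕ} (α : Form m 1) : Prop :=
  IsSmooth α ∧ ∃ p : ℕ, ∀ g : SL m,
    Module.finrank ℝ (tangentSpace g) = 2 * p + 1 ∧ cartanClass α g = 2 * p + 1

/-- The form `θ` is invariant under the left translations by the elements of `H`. -/
def IsInvariantUnder {m k : ℕ} (H : Subgroup (SL m)) (θ : Form m k) : Prop :=
  ∀ h ∈ H, ∀ (g : SL m) (v : Fin k → tangentSpace g),
    θ (h * g) (fun i => leftTranslation h g (v i)) = θ g v

/-- Left invariant forms on `SL(m, ℝ)`. -/
def IsLeftInvariant {m k : ℕ} (θ : Form m k) : Prop := IsInvariantUnder ⊤ θ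

/-- `SO(m, ℝ)` as a subgroup of `SL(m, ℝ)`. -/
def SO (m : ℕ) : Subgroup (SL m) where
  carrier := {g | (g : Mat m).transpose * (g : Mat m) = 1}
  one_mem' := by simp
  mul_mem' := by
    intro a b ha hb
    simp only [Set.mem_ofPred_eq, Matrix.SpecialLinearGroup.coe_mul, Matrix.transpose_mul] at *
    rw [Matrix.mul_assoc, ← Matrix.mul_assoc _ (a : Mat m), ha, Matrix.one_mul, hb]
  inv_mem' := by
    intro a ha
    have h1 : (a : Mat m) * ((a⁻¹ : SL m) : Mat m) = 1 := by
      rw [← Matrix.SpecialLinearGroup.coe_mul, mul_inv_cancel, Matrix.SpecialLinearGroup.coe_one]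
    have h2 : (a : Mat m).transpose = ((a⁻¹ : SL m) : Mat m) := left_inv_eq_right_inv ha h1
    have h3 : ((a⁻¹ : SL m) : Mat m).transpose = (a : Mat m) := by
      rw [← h2, Matrix.transpose_transpose]
    simp only [Set.mem_ofPred_eq]
    rw [h3, h1]

/-! ### The Pfaffian form -/

/-- The coordinate function `x_{jk}`, which is also the (constant) linear form `dx_{jk}`. -/
def coord {m : ℕ} (j k : Fin m) : Mat m →L[ℝ] ℝ :=
  LinearMap.toContinuousLinearMap (Matrix.entryLinearMap ℝ ℝ j k)

@[simp] theorem coord_apply {m : ℕ} (j k : Fin m) (V : Mat m) : coord j k V = V j k := rfl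

/-- The column number `2i - 1` for `i = 1, …, n`, counted from zero. -/
def oddCol {n : ℕ} (i : Fin n) : Fin (2 * n) := ⟨2 * i, by omega⟩

/-- The column number `2i` for `i = 1, …, n`, counted from zero. -/
def evenCol {n : ℕ} (i : Fin n) : Fin (2 * n) := ⟨2 * i + 1, by omega⟩

/-- The Pfaffian form `∑_j ∑_i x_{j,2i-1} dx_{j,2i} - x_{j,2i} dx_{j,2i-1}` on the space of
`2n × 2n` matrices. -/
def omegaTilde (n : ℕ) (X : Mat (2 * n)) : Mat (2 * n) [⋀^Fin 1]→L[ℝ] ℝ :=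
  ContinuousAlternatingMap.ofSubsingleton ℝ (Mat (2 * n)) ℝ 0
    (∑ j : Fin (2 * n), ∑ i : Fin n,
      (X j (oddCol i) • coord j (evenCol i) - X j (evenCol i) • coord j (oddCol i)))

/-- The differential of the determinant, as a `1`-form. -/
def dDet (m : ℕ) (X : Mat m) : Mat m [⋀^Fin 1]→L[ℝ] ℝ :=
  ContinuousAlternatingMap.ofSubsingleton ℝ (Mat m) ℝ 0 (fderiv ℝ (Matrix.det : Mat m → ℝ) X)

/-- The Pfaffian form on `SL(2n, ℝ)`. -/
def omega (n : ℕ) : Form (2 * n) 1 := pullback (omegaTilde n)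

/-! ### The exterior algebra of constant forms on the space of matrices -/

/-- The exterior algebra of the dual of the space of matrices; its product is the wedge product. -/
abbrev ExtAlg (m : ℕ) : Type := ExteriorAlgebra ℝ (Module.Dual ℝ (Mat m))

/-- An alternating `k`-form as an element of the exterior algebra of the dual:
`1/k! ∑ β(E_{f 1}, …, E_{f k}) dx_{f 1} ∧ … ∧ dx_{f k}`, the sum being over all families
`f` of `k` pairs of indices, with `E_{ij}` the matrix units. -/
def toExtAlg {m k : ℕ} (β : Mat m [⋀^Fin k]→L[ℝ] ℝ) : ExtAlg m :=
  ((k ! : ℝ)⁻¹) • ∑ f : Fin k → Fin m × Fin m,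
    β (fun i => Matrix.single (f i).1 (f i).2 1) •
      ExteriorAlgebra.ιMulti ℝ k
        (fun i => ((coord (f i).1 (f i).2).toLinearMap : Module.Dual ℝ (Mat m)))

/-- The volume form `dx_{11} ∧ dx_{12} ∧ … ∧ dx_{mm}`, row after row. -/
def volForm (m : ℕ) : ExtAlg m :=
  ExteriorAlgebra.ιMulti ℝ (m * m) fun k =>
    ((coord (finProdFinEquiv.symm k).1 (finProdFinEquiv.symm k).2).toLinearMap :
      Module.Dual ℝ (Mat m))

end SLForms

end

open scoped ContDiff Topology Nat

noncomputable section

namespace SLForms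

/-! ### Powers of sums of commuting elements of square zero -/

/-! Let σ = ∑ dx_{j,2i-1} ∧ dx_{j,2i} (`symplForm`), a constant nondegenerate 2-form. Then ω̃ at X
is σ(X, ·) and dω̃ = 2σ, while Euler's identity gives dΔ(X) = 2nΔ (`fderiv_det_self`).

Contact: at g in SL the matrix space is the tangent space plus ℝg. A characteristic vector V is
σ-orthogonal to both summands, hence zero.

Volume: σ is a sum of N = 2n² commuting square-zero elements, so σ^N = N!·vol. Contracting the
vanishing form dΔ ∧ σ^N with X gives dΔ(X) σ^N = N dΔ ∧ ω̃ ∧ σ^(N-1) (`ι_mul_pow_mul_ι`).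

Invariance: σ(V, W) depends only on the entries of ᵗV W.

Maximality: if K contains SO and g is in K, the polar decomposition puts the positive factor P of g
in K. The powers of P have bounded trace and det P = 1, so all its eigenvalues are 1.

Left-invariant forms: such a form is ξ = tr(A ·) on the Lie algebra, with dα(V, W) = -ξ([V, W]) at
the identity. Any V commuting with A with tr V = tr(AV) = 0 is characteristic. The centralizer of A
has dimension at least 3 once m ≥ 3 (`three_le_finrank_centralizer`), so a nonzero such V exists. -/

theorem pow_add_of_sq_zero {R : Type*} [Ring R] {u s : R} (h : Commute u s) (hu : u * u = 0)
    (k : ℕ) : (u + s) ^ (k + 1) = s ^ (k + 1) + (k + 1 : ℕ) • (u * s ^ k) := by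
  induction k with
  | zero => simp [add_comm]
  | succ k ih =>
    have h1 : u * s ^ (k + 1) = s ^ (k + 1) * u := (h.pow_right (k + 1)).eq
    have h2 : u * s ^ k * u = 0 := by rw [mul_assoc, ← (h.pow_right k).eq, ← mul_assoc, hu, zero_mul]
    rw [pow_succ, ih, add_mul, mul_add, mul_add, smul_mul_assoc, smul_mul_assoc, h2, ← h1,
      mul_assoc u, ← pow_succ, ← pow_succ, add_smul (k + 1) 1, one_smul]
    rw [smul_zero, zero_add]
    abel

/-- Only the squarefree monomial survives in the expansion. The second conjunct carries the
induction: it kills the pure power of the tail's sum. -/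
theorem sum_pow_length {R : Type*} [Ring R] (l : List R)
    (hc : ∀ a ∈ l, ∀ b ∈ l, Commute a b) (h0 : ∀ a ∈ l, a * a = 0) :
    l.sum ^ l.length = (l.length)! • l.prod ∧ l.sum ^ (l.length + 1) = 0 := by
  induction l with
  | nil => simp
  | cons u l ih =>
    obtain ⟨h1, h2⟩ := ih (fun a ha b hb => hc a (by simp [ha]) b (by simp [hb]))
      (fun a ha => h0 a (by simp [ha]))
    have hu : u * u = 0 := h0 u (by simp)
    have hus : Commute u l.sum := Commute.list_sum_right _ _ fun b hb => hc u (by simp) b (by simp [hb])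
    simp only [List.sum_cons, List.length_cons, List.prod_cons]
    rw [pow_add_of_sq_zero hus hu, pow_add_of_sq_zero hus hu, pow_succ _ (l.length + 1), h2, h1]
    refine ⟨?_, by simp⟩
    rw [zero_add, mul_smul_comm, smul_smul, Nat.factorial_succ]

/-! ### Products and contractions in the exterior algebra -/

section ExteriorAlgebraLemmas

variable {M : Type*} [AddCommGroup M] [Module ℝ M]

open ExteriorAlgebra

theorem ι_mul_swap (a b : M) : ι ℝ a * ι ℝ b = -(ι ℝ b * ι ℝ a) :=
  eq_neg_of_add_eq_zero_left (ι_add_mul_swap a b)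

theorem commute_ι_ι_mul_ι (x a b : M) : Commute (ι ℝ x) (ι ℝ a * ι ℝ b) := by
  rw [commute_iff_eq, ← mul_assoc, ι_mul_swap x a, neg_mul, mul_assoc, ι_mul_swap x b, mul_neg,
    neg_neg, mul_assoc]

theorem ι_mul_ι_sq_zero (a b : M) : (ι ℝ a * ι ℝ b) * (ι ℝ a * ι ℝ b) = 0 := by
  rw [mul_assoc, ← mul_assoc _ (ι ℝ a), ι_mul_swap b a, neg_mul, mul_assoc, ι_sq_zero]
  simp

theorem ι_mul_ιMulti_eq_zero {N : ℕ} (e : Fin N → M) (x : M) (h : Module.finrank ℝ M ≤ N)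
    [FiniteDimensional ℝ M] : ι ℝ x * ιMulti ℝ N e = 0 := by
  have : ιMulti ℝ (N + 1) (Fin.cons x e) = 0 := by
    apply AlternatingMap.map_linearDependent
    intro hl
    have := hl.fintype_card_le_finrank
    simp at this
    omega
  rw [ιMulti_succ_apply] at this
  exact this

/-- Contraction with `ψ` is a derivation with respect to left multiplication by 2-forms. -/
theorem contractLeft_two_form_mul (ψ : Module.Dual ℝ M) (a b : M) (y : ExteriorAlgebra ℝ M) :
    CliffordAlgebra.contractLeft ψ (ι ℝ a * ι ℝ b * y) =
      (ψ a • ι ℝ b - ψ b • ι ℝ a) * y +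
        ι ℝ a * ι ℝ b * CliffordAlgebra.contractLeft ψ y := by
  rw [mul_assoc]
  have h := CliffordAlgebra.contractLeft_ι_mul (Q := (0 : QuadraticForm ℝ M)) ψ a (ι ℝ b * y)
  have h' := CliffordAlgebra.contractLeft_ι_mul (Q := (0 : QuadraticForm ℝ M)) ψ b y
  refine h.trans ?_
  rw [show CliffordAlgebra.contractLeft ψ (ι ℝ b * y) = _ from h', mul_sub, mul_smul_comm, sub_mul,
    smul_mul_assoc, smul_mul_assoc]
  change ψ a • (ι ℝ b * y) - (ψ b • (ι ℝ a * y) - ι ℝ a * (ι ℝ b * _)) = _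
  rw [mul_assoc]
  abel

/-- The Leibniz rule for a power: `w` commutes with `D`, so the `k + 1` terms coincide. -/
theorem contractLeft_pow (ψ : Module.Dual ℝ M) (D w : ExteriorAlgebra ℝ M) (hDw : Commute w D)
    (hD : ∀ y, CliffordAlgebra.contractLeft ψ (D * y) =
      w * y + D * CliffordAlgebra.contractLeft ψ y) (k : ℕ) :
    CliffordAlgebra.contractLeft ψ (D ^ (k + 1)) = (k + 1 : ℕ) • (w * D ^ k) := by
  induction k with
  | zero =>
    have h := hD 1
    rw [show CliffordAlgebra.contractLeft ψ (1 : ExteriorAlgebra ℝ M) = 0 from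
      CliffordAlgebra.contractLeft_one (Q := (0 : QuadraticForm ℝ M)) ψ] at h
    simpa using h
  | succ k ih =>
    rw [pow_succ' D (k + 1), hD, ih, mul_smul_comm, ← mul_assoc D, ← hDw.eq, mul_assoc, ← pow_succ',
      add_smul (k + 1) 1, one_smul, add_comm]

/-- Contract the vanishing product `h0` with `r`; the sign comes from moving `f` past `w`. -/
theorem ι_mul_pow_mul_ι (r : Module.Dual ℝ M) (S : ExteriorAlgebra ℝ M) (w f : M)
    (hS : ∀ x : M, Commute (ι ℝ x) S)
    (hr : ∀ y, CliffordAlgebra.contractLeft r (S * y) =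
      ι ℝ w * y + S * CliffordAlgebra.contractLeft r y) (k : ℕ)
    (h0 : ι ℝ f * S ^ (k + 1) = 0) :
    (k + 1 : ℕ) • (ι ℝ w * S ^ k * ι ℝ f) = -(r f • S ^ (k + 1)) := by
  have h1 : CliffordAlgebra.contractLeft r (ι ℝ f * S ^ (k + 1)) =
      r f • S ^ (k + 1) - ι ℝ f * CliffordAlgebra.contractLeft r (S ^ (k + 1)) :=
    CliffordAlgebra.contractLeft_ι_mul (Q := (0 : QuadraticForm ℝ M)) r f _
  have h2 : ι ℝ w * S ^ k * ι ℝ f = -(ι ℝ f * (ι ℝ w * S ^ k)) := by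
    rw [mul_assoc, ← ((hS f).pow_right _).eq, ← mul_assoc, ι_mul_swap w f, neg_mul, mul_assoc]
  rw [h0, map_zero, contractLeft_pow r S _ (hS w) hr, mul_smul_comm, eq_comm, sub_eq_zero] at h1
  rw [h2, smul_neg, h1]

end ExteriorAlgebraLemmas

/-! ### Forms of degree one on the space of matrices -/

/-- Linear functionals as alternating `1`-forms. -/
def toForm (m : ℕ) : (Mat m →L[ℝ] ℝ) →L[ℝ] Mat m [⋀^Fin 1]→L[ℝ] ℝ :=
  LinearMap.toContinuousLinearMap
    { toFun := ContinuousAlternatingMap.ofSubsingleton ℝ (Mat m) ℝ 0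
      map_add' := fun _ _ => rfl
      map_smul' := fun _ _ => rfl }

theorem toForm_apply {m : ℕ} (f : Mat m →L[ℝ] ℝ) (v : Fin 1 → Mat m) : toForm m f v = f (v 0) := rfl

theorem extDeriv_toForm {m : ℕ} {B : Mat m → Mat m →L[ℝ] ℝ} {X : Mat m}
    {B' : Mat m →L[ℝ] Mat m →L[ℝ] ℝ} (h : HasFDerivAt B B' X) (v : Fin 2 → Mat m) :
    extDeriv (fun X => toForm m (B X)) X v = B' (v 0) (v 1) - B' (v 1) (v 0) := by
  have hd : DifferentiableAt ℝ (fun X => toForm m (B X)) X :=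
    (toForm m).differentiableAt.comp X h.differentiableAt
  have hf : ∀ w : Mat m, fderiv ℝ (fun X => B X w) X = B'.flip w := fun w => by
    have := h.clm_apply (hasFDerivAt_const w X)
    rw [this.fderiv]
    ext V
    simp
  rw [extDeriv_apply hd, Fin.sum_univ_two]
  simp only [toForm_apply, hf]
  simp [Fin.removeNth, sub_eq_add_neg]

theorem eq_sum_single {m : ℕ} (V : Mat m) :
    V = ∑ p : Fin m × Fin m, V p.1 p.2 • Matrix.single p.1 p.2 (1 : ℝ) := by
  rw [Fintype.sum_prod_type]
  conv_lhs => rw [Matrix.matrix_eq_sum_single V]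
  simp [Matrix.smul_single]

theorem eq_sum_coord {m : ℕ} (f : Mat m →L[ℝ] ℝ) :
    ∑ p : Fin m × Fin m, f (Matrix.single p.1 p.2 1) • (coord p.1 p.2).toLinearMap =
      f.toLinearMap := by
  ext V
  conv_rhs => rw [eq_sum_single V]
  simp [mul_comm, -Matrix.smul_single]

theorem toExtAlg_toForm {m : ℕ} (f : Mat m →L[ℝ] ℝ) :
    toExtAlg (toForm m f) = ExteriorAlgebra.ι ℝ (f.toLinearMap : Module.Dual ℝ (Mat m)) := by
  rw [← eq_sum_coord f, toExtAlg, map_sum, Nat.factorial_one, Nat.cast_one, inv_one, one_smul]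
  refine Fintype.sum_equiv (Equiv.funUnique (Fin 1) _) _ _ fun p => ?_
  simp [toForm_apply, ExteriorAlgebra.ιMulti_apply]

/-- The factor 2 in `h` cancels the 1/2! in `toExtAlg`. -/
theorem toExtAlg_two {m : ℕ} (β : Mat m [⋀^Fin 2]→L[ℝ] ℝ) (B : Mat m →L[ℝ] Mat m →L[ℝ] ℝ)
    (h : ∀ v, β v = 2 * B (v 0) (v 1)) :
    toExtAlg β = ∑ p : Fin m × Fin m, ExteriorAlgebra.ι ℝ (coord p.1 p.2).toLinearMap *
      ExteriorAlgebra.ι ℝ ((B (Matrix.single p.1 p.2 1)).toLinearMap : Module.Dual ℝ (Mat m)) := by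
  simp_rw [← eq_sum_coord (B _), map_sum, Finset.mul_sum, map_smul, mul_smul_comm]
  rw [toExtAlg, ← Fintype.sum_prod_type', Finset.smul_sum]
  refine Fintype.sum_equiv (finTwoArrowEquiv _) _ _ fun p => ?_
  rw [h]
  simp [ExteriorAlgebra.ιMulti_apply, smul_smul]
  rfl

/-- Euler's identity for a homogeneous function: differentiate det(tX) = t^m det X at t = 1. -/
theorem fderiv_det_self {m : ℕ} (X : Mat m) :
    fderiv ℝ (Matrix.det : Mat m → ℝ) X X = m * X.det := by
  have h1 : HasDerivAt (fun t : ℝ => (t • X).det) (fderiv ℝ (Matrix.det : Mat m → ℝ) X X) 1 := by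
    have h2 : HasDerivAt (fun t : ℝ => t • X) X 1 := by
      simpa using (hasDerivAt_id (1 : ℝ)).smul_const X
    have h3 : HasFDerivAt (Matrix.det : Mat m → ℝ) (fderiv ℝ (Matrix.det : Mat m → ℝ) X)
        ((1 : ℝ) • X) := by
      rw [one_smul]
      exact (differentiableAt_det X).hasFDerivAt
    exact h3.comp_hasDerivAt 1 h2
  have h4 : HasDerivAt (fun t : ℝ => (t • X).det) (m * X.det) 1 := by
    simp_rw [Matrix.det_smul, Fintype.card_fin]
    simpa using (hasDerivAt_pow m (1 : ℝ)).mul_const X.det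
  exact h1.unique h4

theorem finrank_tangentSpace {m : ℕ} (hm : 1 ≤ m) (g : SL m) :
    Module.finrank ℝ (tangentSpace g) + 1 = m * m := by
  have h : (fderiv ℝ (Matrix.det : Mat m → ℝ) (g : Mat m)).toLinearMap ≠ 0 := fun h => by
    have h1 := fderiv_det_self (g : Mat m)
    have h2 : fderiv ℝ (Matrix.det : Mat m → ℝ) (g : Mat m) (g : Mat m) = 0 :=
      congrArg (fun L => L (g : Mat m)) h
    rw [h2, g.2] at h1
    have : (m : ℝ) ≠ 0 := by positivity
    simp [eq_comm, this] at h1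
  have := Module.Dual.finrank_ker_add_one_of_ne_zero (f := (fderiv ℝ (Matrix.det : Mat m → ℝ) (g : Mat m)).toLinearMap) h
  rw [this, Module.finrank_matrix]
  simp

/-! ### The symplectic form -/

theorem oddCol_or_evenCol {n : ℕ} (k : Fin (2 * n)) : (∃ i, k = oddCol i) ∨ ∃ i, k = evenCol i := by
  rcases Nat.even_or_odd' (k : ℕ) with ⟨i, h | h⟩
  · exact Or.inl ⟨⟨i, by omega⟩, Fin.ext h⟩
  · exact Or.inr ⟨⟨i, by omega⟩, Fin.ext h⟩

theorem oddCol_ne_evenCol {n : ℕ} (i k : Fin n) : oddCol i ≠ evenCol k := fun h => by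
  have := congrArg Fin.val h
  simp only [oddCol, evenCol] at this
  omega

theorem oddCol_injective {n : ℕ} : Function.Injective (oddCol : Fin n → Fin (2 * n)) :=
  fun i k h => by
    have := congrArg Fin.val h
    simp only [oddCol] at this
    omega

theorem evenCol_injective {n : ℕ} : Function.Injective (evenCol : Fin n → Fin (2 * n)) :=
  fun i k h => by
    have := congrArg Fin.val h
    simp only [evenCol] at this
    omega

/-- The symplectic form `∑ dx_{j,2i-1} ∧ dx_{j,2i}` as a bilinear form. -/
def symplForm (n : ℕ) : Mat (2 * n) →L[ℝ] Mat (2 * n) →L[ℝ] ℝ :=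
  ∑ j : Fin (2 * n), ∑ i : Fin n,
    ((coord j (oddCol i)).smulRight (coord j (evenCol i)) -
      (coord j (evenCol i)).smulRight (coord j (oddCol i)))

theorem symplForm_apply {n : ℕ} (V : Mat (2 * n)) :
    symplForm n V = ∑ j : Fin (2 * n), ∑ i : Fin n,
      (V j (oddCol i) • coord j (evenCol i) - V j (evenCol i) • coord j (oddCol i)) := by
  simp [symplForm]

theorem symplForm_apply_apply {n : ℕ} (V W : Mat (2 * n)) :
    symplForm n V W = ∑ j : Fin (2 * n), ∑ i : Fin n,
      (V j (oddCol i) * W j (evenCol i) - V j (evenCol i) * W j (oddCol i)) := by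
  simp [symplForm_apply]

theorem symplForm_swap {n : ℕ} (V W : Mat (2 * n)) : symplForm n V W = -symplForm n W V := by
  simp_rw [symplForm_apply_apply, ← Finset.sum_neg_distrib]
  refine Finset.sum_congr rfl fun j _ => Finset.sum_congr rfl fun i _ => ?_
  ring

/-- Pairing with a matrix unit in the partner column isolates one entry of `V` up to sign. -/
theorem symplForm_nondegenerate {n : ℕ} {V : Mat (2 * n)} (h : ∀ W, symplForm n V W = 0) :
    V = 0 := by
  ext j k
  rcases oddCol_or_evenCol k with ⟨i, rfl⟩ | ⟨i, rfl⟩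
  · have := h (Matrix.single j (evenCol i) 1)
    simpa [symplForm_apply_apply, Matrix.single_apply, oddCol_ne_evenCol, (oddCol_ne_evenCol _ _).symm,
      evenCol_injective.eq_iff, ite_and] using this
  · have := h (Matrix.single j (oddCol i) 1)
    simpa [symplForm_apply_apply, Matrix.single_apply, oddCol_ne_evenCol, (oddCol_ne_evenCol _ _).symm,
      oddCol_injective.eq_iff, ite_and] using this

theorem omegaTilde_eq (n : ℕ) : omegaTilde n = fun X => toForm (2 * n) (symplForm n X) := by
  funext X
  rw [symplForm_apply]
  rfl

/-- `omegaTilde` is linear in `X`, so its derivative is `symplForm`; antisymmetrizing an alternating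
form doubles it. -/
theorem extDeriv_omegaTilde {n : ℕ} (X : Mat (2 * n)) (v : Fin 2 → Mat (2 * n)) :
    extDeriv (omegaTilde n) X v = 2 * symplForm n (v 0) (v 1) := by
  rw [omegaTilde_eq, extDeriv_toForm (symplForm n).hasFDerivAt, symplForm_swap (v 1)]
  ring

/-! ### Contact property and orthogonal invariance of `omega` -/

theorem isLocalExtension_omega {n : ℕ} (g : SL (2 * n)) :
    IsLocalExtension (omega n) g (omegaTilde n) := by
  refine ⟨Set.univ, isOpen_univ, trivial, ?_, fun _ _ => rfl⟩
  rw [omegaTilde_eq]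
  exact ((toForm (2 * n)).contDiff.comp (symplForm n).contDiff).contDiffOn

theorem mem_characteristicSpace_iff {m : ℕ} {α : Form m 1} {g : SL m} {V : tangentSpace g} :
    V ∈ characteristicSpace α g ↔ α g (fun _ => V) = 0 ∧ ∀ W, d α g ![V, W] = 0 := by
  rw [characteristicSpace, Submodule.mem_inf, LinearMap.mem_ker, LinearMap.mem_ker]
  refine and_congr ⟨fun h => ?_, fun h => ?_⟩ ⟨fun h W => ?_, fun h => ?_⟩
  · have := congrArg (fun L => L ![]) h
    simp only [ContinuousLinearMap.coe_coe, ContinuousAlternatingMap.curryLeft_apply_apply] at this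
    rwa [show (fun _ => V : Fin 1 → _) = Matrix.vecCons V ![] by ext i; simp]
  · ext v
    rw [ContinuousLinearMap.coe_coe, ContinuousAlternatingMap.curryLeft_apply_apply]
    rw [show (fun _ => V : Fin 1 → _) = Matrix.vecCons V v by ext i; simp] at h
    exact h
  · exact congrArg (fun L => L ![W]) h
  · ext v
    rw [ContinuousLinearMap.coe_coe, ContinuousAlternatingMap.curryLeft_apply_apply]
    have hv : v = ![v 0] := by
      funext i
      obtain rfl : i = 0 := Subsingleton.elim (α := Fin 1) i 0
      rfl
    rw [hv]
    exact h (v 0)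

theorem characteristicSpace_omega {n : ℕ} (hn : 1 ≤ n) (g : SL (2 * n)) :
    characteristicSpace (omega n) g = ⊥ := by
  rw [eq_bot_iff]
  intro V hV
  rw [mem_characteristicSpace_iff, d_eq (isLocalExtension_omega g)] at hV
  obtain ⟨h1, h2⟩ := hV
  have h1' : symplForm n (g : Mat (2 * n)) V = 0 := by
    rw [omega, omegaTilde_eq] at h1
    exact h1
  have h2' : ∀ W : tangentSpace g, symplForm n (V : Mat (2 * n)) W = 0 := fun W => by
    have h3 := h2 W
    rw [pullback, ContinuousAlternatingMap.compContinuousLinearMap_apply, extDeriv_omegaTilde] at h3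
    simpa using h3
  rw [Submodule.mem_bot, ← Submodule.coe_eq_zero]
  refine symplForm_nondegenerate fun W => ?_
  have hn0 : ((2 * n : ℕ) : ℝ) ≠ 0 := by positivity
  -- By Euler's identity this `t` is the coefficient of `g` in the splitting of `W` along the
  -- tangent space and the line of `g`.
  set t := fderiv ℝ (Matrix.det : Mat (2 * n) → ℝ) (g : Mat (2 * n)) W / (2 * n : ℕ) with ht
  have hW : W - t • (g : Mat (2 * n)) ∈ tangentSpace g := by
    rw [LinearMap.mem_ker, ContinuousLinearMap.coe_coe, map_sub, map_smul, fderiv_det_self, g.2, ht,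
      smul_eq_mul, mul_one, div_mul_cancel₀ _ hn0, sub_self]
  have h4 := h2' ⟨_, hW⟩
  rw [map_sub, map_smul, symplForm_swap _ (g : Mat (2 * n)), h1'] at h4
  simpa using h4

theorem isContactForm_omega {n : ℕ} (hn : 1 ≤ n) : IsContactForm (omega n) := by
  refine ⟨fun g => ⟨_, isLocalExtension_omega g⟩, 2 * n ^ 2 - 1, fun g => ?_⟩
  have h1 := finrank_tangentSpace (m := 2 * n) (by omega) g
  have h2 : 1 ≤ n ^ 2 := Nat.one_le_pow _ _ hn
  have h3 : Module.finrank ℝ (tangentSpace g) = 2 * (2 * n ^ 2 - 1) + 1 := by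
    rw [show 2 * n * (2 * n) = 4 * n ^ 2 by ring] at h1
    omega
  refine ⟨h3, ?_⟩
  have h4 := (characteristicSpace (omega n) g).finrank_quotient_add_finrank
  rw [characteristicSpace_omega hn, finrank_bot, add_zero] at h4
  rw [cartanClass, characteristicSpace_omega hn, h4, h3]

/-- For each pair of columns, the sum over rows is an entry of ᵗV W, which orthogonal left
multiplication preserves. -/
theorem symplForm_mul_mul {n : ℕ} {A : Mat (2 * n)} (hA : A.transpose * A = 1)
    (V W : Mat (2 * n)) : symplForm n (A * V) (A * W) = symplForm n V W := by
  have key : ∀ k l : Fin (2 * n), ∑ j, (A * V) j k * (A * W) j l = ∑ j, V j k * W j l := by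
    intro k l
    have : (A * V).transpose * (A * W) = V.transpose * W := by
      rw [Matrix.transpose_mul, Matrix.mul_assoc, ← Matrix.mul_assoc _ A, hA, Matrix.one_mul]
    have h := congrFun (congrFun this k) l
    rw [Matrix.mul_apply, Matrix.mul_apply] at h
    exact h
  simp_rw [symplForm_apply_apply]
  rw [Finset.sum_comm, Finset.sum_comm (s := Finset.univ (α := Fin (2 * n)))]
  refine Finset.sum_congr rfl fun i _ => ?_
  rw [Finset.sum_sub_distrib, Finset.sum_sub_distrib, key, key]

theorem isInvariantUnder_SO_omega (n : ℕ) : IsInvariantUnder (SO (2 * n)) (omega n) := by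
  intro h hh g v
  rw [omega, omegaTilde_eq]
  change symplForm n ((h * g : SL (2 * n)) : Mat (2 * n)) ((h : Mat (2 * n)) * (v 0 : Mat (2 * n))) =
    symplForm n (g : Mat (2 * n)) (v 0)
  rw [Matrix.SpecialLinearGroup.coe_mul]
  exact symplForm_mul_mul hh _ _

section VolumeIdentity

open ExteriorAlgebra

/-! ### The volume identity -/

/-- The `2`-form `dx_{j,2i-1} ∧ dx_{j,2i}`. -/
def elemTwoForm {n : ℕ} (j : Fin (2 * n)) (i : Fin n) : ExtAlg (2 * n) :=
  ι ℝ (coord j (oddCol i)).toLinearMap * ι ℝ (coord j (evenCol i)).toLinearMap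

theorem ι_symplForm {n : ℕ} (V : Mat (2 * n)) :
    (ι ℝ (symplForm n V).toLinearMap : ExtAlg (2 * n)) =
      ∑ j : Fin (2 * n), ∑ i : Fin n, (V j (oddCol i) • ι ℝ (coord j (evenCol i)).toLinearMap -
        V j (evenCol i) • ι ℝ (coord j (oddCol i)).toLinearMap) := by
  have h : (symplForm n V).toLinearMap = ∑ j : Fin (2 * n), ∑ i : Fin n,
      (V j (oddCol i) • (coord j (evenCol i)).toLinearMap -
        V j (evenCol i) • (coord j (oddCol i)).toLinearMap) := by
    ext W
    simp [symplForm_apply]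
  rw [h]
  simp only [map_sum, map_sub, map_smul]

theorem toExtAlg_extDeriv_omegaTilde {n : ℕ} (X : Mat (2 * n)) :
    toExtAlg (extDeriv (omegaTilde n) X) =
      2 * ∑ j : Fin (2 * n), ∑ i : Fin n, elemTwoForm j i := by
  have key : ∀ j k : Fin (2 * n), ∑ p : Fin (2 * n) × Fin (2 * n),
      (Matrix.single p.1 p.2 (1 : ℝ) : Mat (2 * n)) j k •
        (ι ℝ (coord p.1 p.2).toLinearMap : ExtAlg (2 * n)) = ι ℝ (coord j k).toLinearMap := by
    intro j k
    rw [← eq_sum_coord (coord j k), map_sum]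
    simp_rw [map_smul, coord_apply]
  rw [toExtAlg_two _ (symplForm n) (extDeriv_omegaTilde X)]
  simp_rw [ι_symplForm, Finset.mul_sum]
  rw [Finset.sum_comm]
  refine Finset.sum_congr rfl fun j _ => ?_
  rw [Finset.sum_comm]
  refine Finset.sum_congr rfl fun i _ => ?_
  simp_rw [mul_sub, mul_smul_comm, ← smul_mul_assoc]
  rw [Finset.sum_sub_distrib, ← Finset.sum_mul, ← Finset.sum_mul, key, key,
    ι_mul_swap (coord j (evenCol i)).toLinearMap, sub_neg_eq_add, ← two_mul]
  rfl

/-- Columns 2i-1 and 2i are adjacent in the row-after-row order, so pairing the factors needs no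
permutation and no sign. -/
theorem elemTwoForm_list_prod (n : ℕ) :
    (List.ofFn fun j : Fin (2 * n) => List.ofFn fun i : Fin n => elemTwoForm j i).flatten.prod =
      volForm (2 * n) := by
  rw [volForm, ιMulti_apply, List.ofFn_mul (m := 2 * n) (n := 2 * n)
    (f := fun i => ι ℝ _), List.prod_flatten, List.prod_flatten, List.map_ofFn, List.map_ofFn]
  congr 2
  funext j
  simp only [Function.comp_apply]
  rw [List.ofFn_mul' (m := 2) (n := n) (f := fun i => ι ℝ _), List.prod_flatten, List.map_ofFn]
  congr 2
  funext i
  have h : ∀ (k : ℕ) (hk : k < 2 * n) (hlt : (j : ℕ) * (2 * n) + k < 2 * n * (2 * n)),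
      finProdFinEquiv.symm (⟨j * (2 * n) + k, hlt⟩ : Fin (2 * n * (2 * n))) = (j, ⟨k, hk⟩) := by
    intro k hk hlt
    rw [Equiv.symm_apply_eq]
    ext
    simp [finProdFinEquiv, add_comm, mul_comm]
  have h1 := h (2 * i + 1) (by omega)
  simp [h, h1, elemTwoForm, oddCol, evenCol, -finProdFinEquiv_symm_apply]

theorem elemTwoForm_sum_pow (n : ℕ) :
    (∑ j : Fin (2 * n), ∑ i : Fin n, (elemTwoForm j i : ExtAlg (2 * n))) ^ (2 * n ^ 2) =
      (2 * n ^ 2)! • volForm (2 * n) := by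
  have h := (sum_pow_length
    (List.ofFn fun j : Fin (2 * n) => List.ofFn fun i : Fin n => elemTwoForm j i).flatten ?_ ?_).1
  · rw [elemTwoForm_list_prod, List.sum_flatten, List.map_ofFn, List.sum_ofFn] at h
    have hl : (List.ofFn fun j : Fin (2 * n) => List.ofFn fun i : Fin n =>
        (elemTwoForm j i : ExtAlg (2 * n))).flatten.length = 2 * n ^ 2 := by
      simp [List.length_flatten, List.map_ofFn, Function.comp_def]
      ring
    rw [hl] at h
    simpa [List.sum_ofFn] using h
  · simp only [List.mem_flatten, List.mem_ofFn]
    rintro _ ⟨_, ⟨j, rfl⟩, hj⟩ _ ⟨_, ⟨k, rfl⟩, hk⟩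
    obtain ⟨i, rfl⟩ := (List.mem_ofFn' _ _).1 hj
    obtain ⟨l, rfl⟩ := (List.mem_ofFn' _ _).1 hk
    exact (commute_ι_ι_mul_ι _ _ _).mul_left (commute_ι_ι_mul_ι _ _ _)
  · simp only [List.mem_flatten, List.mem_ofFn]
    rintro _ ⟨_, ⟨j, rfl⟩, hj⟩
    obtain ⟨i, rfl⟩ := (List.mem_ofFn' _ _).1 hj
    exact ι_mul_ι_sq_zero _ _

/-- The interior product of σ with the Euler vector `X` is ω̃ at `X`; this supplies the hypothesis
`hr` of `ι_mul_pow_mul_ι`. -/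
theorem contractLeft_sum_elemTwoForm_mul {n : ℕ} (X : Mat (2 * n)) (y : ExtAlg (2 * n)) :
    CliffordAlgebra.contractLeft (Module.Dual.eval ℝ (Mat (2 * n)) X)
        ((∑ j : Fin (2 * n), ∑ i : Fin n, elemTwoForm j i) * y) =
      ι ℝ (symplForm n X).toLinearMap * y + (∑ j : Fin (2 * n), ∑ i : Fin n, elemTwoForm j i) *
        CliffordAlgebra.contractLeft (Module.Dual.eval ℝ (Mat (2 * n)) X) y := by
  rw [ι_symplForm]
  simp only [Finset.sum_mul, map_sum, ← Finset.sum_add_distrib]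
  exact Finset.sum_congr rfl fun j _ => Finset.sum_congr rfl fun i _ =>
    contractLeft_two_form_mul _ _ _ y

theorem omegaTilde_wedge_identity {n : ℕ} (hn : 1 ≤ n) :
    ∃ c : ℝ, c ≠ 0 ∧ ∀ X : Mat (2 * n),
      toExtAlg (omegaTilde n X) * toExtAlg (extDeriv (omegaTilde n) X) ^ (2 * n ^ 2 - 1) *
          toExtAlg (dDet (2 * n) X) =
        (c * X.det) • volForm (2 * n) := by
  obtain ⟨k, hk⟩ : ∃ k, 2 * n ^ 2 = k + 1 := by
    have : 1 ≤ n ^ 2 := Nat.one_le_pow _ _ hn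
    exact ⟨2 * n ^ 2 - 1, by omega⟩
  -- Here `2 ^ k` comes from dω̃ = 2σ, the inverse and the sign from the contraction, `2 * n` from
  -- Euler's identity and the factorial from the top power of σ.
  refine ⟨-(2 ^ k * ((k + 1 : ℕ) : ℝ)⁻¹ * (2 * n : ℕ) * (k + 1)!), ?_, fun X => ?_⟩
  · have h1 : ((2 * n : ℕ) : ℝ) ≠ 0 := by positivity
    have h2 : ((k + 1 : ℕ) : ℝ) ≠ 0 := by positivity
    have h3 : ((k + 1)! : ℝ) ≠ 0 := by positivity
    exact neg_ne_zero.2 (mul_ne_zero (mul_ne_zero (mul_ne_zero (by positivity) (inv_ne_zero h2)) h1) h3)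
  have hpow := elemTwoForm_sum_pow n
  have hD := toExtAlg_extDeriv_omegaTilde X
  have hcon := contractLeft_sum_elemTwoForm_mul X
  have hS : ∀ x, Commute (ι ℝ x) (∑ j : Fin (2 * n), ∑ i : Fin n, elemTwoForm j i) := fun x =>
    Commute.sum_right _ _ _ fun j _ => Commute.sum_right _ _ _ fun i _ => commute_ι_ι_mul_ι _ _ _
  generalize (∑ j : Fin (2 * n), ∑ i : Fin n, elemTwoForm j i) = S at hpow hD hcon hS
  have h1 : toExtAlg (omegaTilde n X) = ι ℝ (symplForm n X).toLinearMap := by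
    rw [omegaTilde_eq, toExtAlg_toForm]
  have hdf : toExtAlg (dDet (2 * n) X) =
      ι ℝ (fderiv ℝ (Matrix.det : Mat (2 * n) → ℝ) X).toLinearMap := toExtAlg_toForm _
  have hr : Module.Dual.eval ℝ (Mat (2 * n)) X
      (fderiv ℝ (Matrix.det : Mat (2 * n) → ℝ) X).toLinearMap = (2 * n : ℕ) * X.det :=
    fderiv_det_self X
  rw [hk] at hpow ⊢
  have h0 : ∀ f : Module.Dual ℝ (Mat (2 * n)), ι ℝ f * S ^ (k + 1) = 0 := fun f => by
    rw [hpow, mul_smul_comm, volForm, ι_mul_ιMulti_eq_zero, smul_zero]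
    rw [Subspace.dual_finrank_eq, Module.finrank_matrix]
    simp
  have h5 := ι_mul_pow_mul_ι _ S _ _ hS hcon k
    (h0 (fderiv ℝ (Matrix.det : Mat (2 * n) → ℝ) X).toLinearMap)
  rw [hr, hpow, ← Nat.cast_smul_eq_nsmul ℝ, ← Nat.cast_smul_eq_nsmul ℝ] at h5
  have hne : ((k + 1 : ℕ) : ℝ) ≠ 0 := by positivity
  have h6 := congrArg (fun z => ((k + 1 : ℕ) : ℝ)⁻¹ • z) h5
  simp only [inv_smul_smul₀ hne] at h6
  have h7 : (2 * S) ^ k = (2 : ℝ) ^ k • S ^ k := by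
    have h8 : 2 * S = (2 : ℝ) • S := by rw [two_smul, two_mul S]
    rw [h8, smul_pow]
  rw [h1, hdf, hD, Nat.add_sub_cancel, h7, mul_smul_comm, smul_mul_assoc, h6]
  simp only [smul_smul, ← neg_smul]
  congr 1
  ring

end VolumeIdentity

/-! ### Maximal compactness of `SO(m, ℝ)` -/

/-- The columns are unit vectors, so all entries lie in [-1, 1]. -/
theorem isCompact_orthogonal (m : ℕ) : IsCompact {X : Mat m | X.transpose * X = 1} := by
  have hbox : IsCompact (Set.univ.pi fun _ : Fin m => Set.univ.pi fun _ : Fin m =>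
      Set.Icc (-1 : ℝ) 1) := isCompact_univ_pi fun _ => isCompact_univ_pi fun _ => isCompact_Icc
  refine IsCompact.of_isClosed_subset (X := Mat m) hbox ?_ ?_
  · exact isClosed_eq (continuous_id.matrix_transpose.matrix_mul continuous_id) continuous_const
  · intro X hX i _ j _
    have h : (X.transpose * X) j j = 1 := by rw [show X.transpose * X = 1 from hX, Matrix.one_apply_eq]
    rw [Matrix.mul_apply] at h
    have h1 : X i j * X i j ≤ 1 := by
      rw [← h]
      exact Finset.single_le_sum (f := fun k => X k j * X k j)
        (fun k _ => mul_self_nonneg _) (Finset.mem_univ i)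
    exact abs_le.1 ((sq_le_one_iff_abs_le_one _).1 (by rw [sq]; exact h1))

theorem isCompact_SO (m : ℕ) : IsCompact (SO m : Set (SL m)) :=
  Matrix.SpecialLinearGroup.isClosedEmbedding_val.isCompact_preimage (isCompact_orthogonal m)

/-- Orthogonal diagonalization of the Gram matrix of the columns of `g`. -/
theorem exists_diagonalization_gram {m : ℕ} (g : SL m) :
    ∃ (U : Mat m) (s : Fin m → ℝ), U.transpose * U = 1 ∧ U * U.transpose = 1 ∧ (∀ i, 0 ≤ s i) ∧
      ∏ i, s i = 1 ∧
      (g : Mat m).transpose * (g : Mat m) = U * Matrix.diagonal (fun i => s i * s i) * U.transpose := by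
  have hS : ((g : Mat m).transpose * (g : Mat m)).IsHermitian :=
    Matrix.isHermitian_conjTranspose_mul_self (g : Mat m)
  have hpos : ((g : Mat m).transpose * (g : Mat m)).PosSemidef :=
    Matrix.posSemidef_conjTranspose_mul_self (g : Mat m)
  have h0 : ∀ i, 0 ≤ hS.eigenvalues i := fun i => hpos.eigenvalues_nonneg i
  have hdet := hS.det_eq_prod_eigenvalues
  rw [Matrix.det_mul, Matrix.det_transpose, g.2, mul_one] at hdet
  refine ⟨hS.eigenvectorUnitary, fun i => √(hS.eigenvalues i), ?_, ?_, fun i => Real.sqrt_nonneg _,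
    ?_, ?_⟩
  · exact Unitary.coe_star_mul_self hS.eigenvectorUnitary
  · exact Unitary.coe_mul_star_self hS.eigenvectorUnitary
  · rw [← Real.sqrt_prod _ fun i _ => h0 i]
    rw [show (∏ i, hS.eigenvalues i) = 1 from hdet.symm, Real.sqrt_one]
  · simp_rw [Real.mul_self_sqrt (h0 _)]
    conv_lhs => rw [hS.spectral_theorem, Unitary.conjStarAlgAut_apply]
    rfl

theorem le_one_of_pow_le {x C : ℝ} (h : ∀ k : ℕ, x ^ k ≤ C) : x ≤ 1 := by
  by_contra! hx
  obtain ⟨k, hk⟩ := pow_unbounded_of_one_lt C hx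
  exact (h k).not_gt hk

theorem eq_one_of_prod_eq_one {ι : Type*} [Fintype ι] {s : ι → ℝ} (h0 : ∀ i, 0 ≤ s i)
    (h1 : ∀ i, s i ≤ 1) (h : ∏ i, s i = 1) (i : ι) : s i = 1 := by
  classical
  refine le_antisymm (h1 i) ?_
  rw [← h, ← Finset.mul_prod_erase _ _ (Finset.mem_univ i)]
  exact mul_le_of_le_one_right (h0 i) (Finset.prod_le_one (fun k _ => h0 k) fun k _ => h1 k)

theorem eq_SO_of_isCompact {m : ℕ} (K : Subgroup (SL m)) (hK : IsCompact (K : Set (SL m)))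
    (hle : SO m ≤ K) : K = SO m := by
  refine le_antisymm (fun g hg => ?_) hle
  obtain ⟨U, s, hU1, hU2, hs0, hs1, hgU⟩ := exists_diagonalization_gram g
  have hdetU : U.det * U.det = 1 := by
    have := congrArg Matrix.det hU1
    rwa [Matrix.det_mul, Matrix.det_transpose, Matrix.det_one] at this
  -- The positive square root of ᵗg g, that is, the symmetric factor of the polar decomposition.
  set p : Mat m := U * Matrix.diagonal s * U.transpose with hp
  have hpdet : p.det = 1 := by
    rw [hp, Matrix.det_mul, Matrix.det_mul, Matrix.det_transpose, Matrix.det_diagonal, hs1, mul_one,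
      hdetU]
  have hpt : p.transpose = p := by
    rw [hp, Matrix.transpose_mul, Matrix.transpose_mul, Matrix.transpose_transpose,
      Matrix.diagonal_transpose, Matrix.mul_assoc]
  have hpow : ∀ k : ℕ, p ^ k = U * Matrix.diagonal (fun i => s i ^ k) * U.transpose := by
    intro k
    induction k with
    | zero => simp [hU2]
    | succ k ih =>
      rw [pow_succ, ih, hp]
      calc _ = U * Matrix.diagonal (fun i => s i ^ k) * (U.transpose * U) * Matrix.diagonal s *
            U.transpose := by simp only [Matrix.mul_assoc]
        _ = _ := by
          rw [hU1, Matrix.mul_one, Matrix.mul_assoc U, Matrix.diagonal_mul_diagonal]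
          simp_rw [pow_succ]
  have hpp : p * p = (g : Mat m).transpose * (g : Mat m) := by
    rw [← sq, hpow, hgU]
    simp_rw [sq]
  let P : SL m := ⟨p, hpdet⟩
  have hPQ : p * ((P⁻¹ : SL m) : Mat m) = 1 := by
    have := congrArg (fun x : SL m => (x : Mat m)) (mul_inv_cancel P)
    simpa only [Matrix.SpecialLinearGroup.coe_mul, Matrix.SpecialLinearGroup.coe_one] using this
  have hQP : ((P⁻¹ : SL m) : Mat m).transpose * p = 1 := by
    have := congrArg Matrix.transpose hPQ
    rwa [Matrix.transpose_mul, hpt, Matrix.transpose_one] at this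
  have hk : g * P⁻¹ ∈ SO m := by
    change ((g * P⁻¹ : SL m) : Mat m).transpose * ((g * P⁻¹ : SL m) : Mat m) = 1
    rw [Matrix.SpecialLinearGroup.coe_mul, Matrix.transpose_mul]
    calc _ = ((P⁻¹ : SL m) : Mat m).transpose * ((g : Mat m).transpose * (g : Mat m)) *
          ((P⁻¹ : SL m) : Mat m) := by simp only [Matrix.mul_assoc]
      _ = _ := by rw [← hpp, ← Matrix.mul_assoc, hQP, Matrix.one_mul, hPQ]
  -- The orthogonal factor `g * P⁻¹` lies in `SO m ≤ K`, so `P` does too.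
  have hPK : P ∈ K := by
    have := K.mul_mem (K.inv_mem (hle hk)) hg
    simpa using this
  -- The trace is bounded on `K`, and that of `P ^ k` is ∑ s_i^k with nonnegative terms.
  have htr : Continuous fun x : SL m => (x : Mat m).trace := continuous_subtype_val.matrix_trace
  obtain ⟨C, hC⟩ := (hK.image htr).bddAbove
  have hle1 : ∀ i, s i ≤ 1 := fun i => by
    refine le_one_of_pow_le (C := C) fun k => ?_
    have h1 : (((P ^ k : SL m) : Mat m)).trace ≤ C := hC ⟨P ^ k, K.pow_mem hPK k, rfl⟩
    have h2 : ((P ^ k : SL m) : Mat m) = p ^ k := Matrix.SpecialLinearGroup.coe_pow P k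
    rw [h2, hpow, Matrix.trace_mul_comm, ← Matrix.mul_assoc, hU1, Matrix.one_mul,
      Matrix.trace_diagonal] at h1
    exact (Finset.single_le_sum (f := fun i => s i ^ k) (fun i _ => pow_nonneg (hs0 i) k)
      (Finset.mem_univ i)).trans h1
  have hone : ∀ i, s i = 1 := eq_one_of_prod_eq_one hs0 hle1 hs1
  change (g : Mat m).transpose * (g : Mat m) = 1
  rw [hgU]
  simp [hone, hU2]

/-! ### Centralizers of matrices -/

/-- The space of matrices commuting with `A`. -/
def centralizer {m : ℕ} (A : Mat m) : Submodule ℝ (Mat m) :=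
  LinearMap.ker (LinearMap.mulLeft ℝ A - LinearMap.mulRight ℝ A)

theorem mem_centralizer {m : ℕ} {A V : Mat m} : V ∈ centralizer A ↔ A * V = V * A := by
  rw [centralizer, LinearMap.mem_ker, LinearMap.sub_apply, sub_eq_zero]
  rfl

/-- If `A² = aA + b` and `x`, `Ax` are independent, the matrices `AM + MA - aM` with `M = x yᵗ`
commute with `A` and depend injectively on `y`. -/
theorem le_finrank_centralizer_of_quadratic {m : ℕ} {A : Mat m} {a b : ℝ}
    (hA : A * A = a • A + b • 1) {x : Fin m → ℝ} (hx : LinearIndependent ℝ ![x, A.mulVec x]) :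
    m ≤ Module.finrank ℝ (centralizer A) := by
  let T : (Fin m → ℝ) →ₗ[ℝ] Mat m :=
    { toFun := fun y => A * Matrix.vecMulVec x y + Matrix.vecMulVec x y * A -
        a • Matrix.vecMulVec x y
      map_add' := fun y z => by
        rw [Matrix.vecMulVec_add, mul_add, add_mul, smul_add]
        abel
      map_smul' := fun c y => by
        rw [Matrix.vecMulVec_smul, mul_smul_comm, smul_mul_assoc, smul_comm a, RingHom.id_apply,
          smul_sub, smul_add] }
  have hT : ∀ y, T y ∈ centralizer A := fun y => by
    rw [mem_centralizer]
    change A * (A * Matrix.vecMulVec x y + Matrix.vecMulVec x y * A - a • Matrix.vecMulVec x y) =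
      (A * Matrix.vecMulVec x y + Matrix.vecMulVec x y * A - a • Matrix.vecMulVec x y) * A
    generalize Matrix.vecMulVec x y = M
    simp only [mul_sub, mul_add, sub_mul, add_mul, ← mul_assoc, hA]
    simp only [mul_assoc, hA, mul_smul_comm, smul_mul_assoc, mul_add, mul_one, one_mul]
    abel
  have hinj : Function.Injective (T.codRestrict (centralizer A) hT) := by
    rw [← LinearMap.ker_eq_bot, LinearMap.ker_codRestrict, LinearMap.ker_eq_bot']
    intro y hy
    funext j
    -- Column `j` of `T y = 0`; independence of `x` and `Ax` then gives `y j = 0`.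
    have h1 : (Matrix.vecMul y A j - a * y j) • x + y j • A.mulVec x = 0 := by
      funext i
      have := congrFun (congrFun hy i) j
      change (A * Matrix.vecMulVec x y + Matrix.vecMulVec x y * A -
        a • Matrix.vecMulVec x y) i j = 0 at this
      rw [Matrix.mul_vecMulVec, Matrix.vecMulVec_mul] at this
      simp only [Matrix.sub_apply, Matrix.add_apply, Matrix.smul_apply, Matrix.vecMulVec_apply,
        smul_eq_mul] at this
      simp only [Pi.add_apply, Pi.smul_apply, smul_eq_mul, Pi.zero_apply]
      linarith
    exact (LinearIndependent.pair_iff.1 hx _ _ h1).2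
  simpa using LinearMap.finrank_le_finrank_of_injective hinj

/-- Either 1, A, A² are independent elements of the centralizer, or every vector is an eigenvector
and `A` is scalar, or `A` is a nonscalar root of a quadratic polynomial and
`le_finrank_centralizer_of_quadratic` applies. -/
theorem three_le_finrank_centralizer {m : ℕ} (hm : 3 ≤ m) (A : Mat m) :
    3 ≤ Module.finrank ℝ (centralizer A) := by
  by_cases h3 : LinearIndependent ℝ ![1, A, A * A]
  · have hmem : ∀ i, (![1, A, A * A] : Fin 3 → Mat m) i ∈ centralizer A := by
      intro i
      rw [mem_centralizer]
      fin_cases i <;> simp [mul_assoc]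
    have h : LinearIndependent ℝ fun i => (⟨_, hmem i⟩ : centralizer A) :=
      LinearIndependent.of_comp (centralizer A).subtype h3
    simpa using h.fintype_card_le_finrank
  by_cases hs : ∀ x, ¬ LinearIndependent ℝ ![x, A.mulVecLin x]
  · obtain ⟨a, ha⟩ := LinearMap.exists_eq_smul_id_of_forall_notLinearIndependent hs
    have hA : A = a • 1 := by
      apply Matrix.toLin'.injective
      rw [Matrix.toLin'_apply', ha, map_smul, Matrix.toLin'_one]
      rfl
    have htop : centralizer A = ⊤ := by
      rw [eq_top_iff]
      intro V _
      rw [mem_centralizer, hA]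
      simp
    rw [htop, finrank_top, Module.finrank_matrix]
    simp
    nlinarith
  push Not at hs
  obtain ⟨x, hx⟩ := hs
  rw [Matrix.mulVecLin_apply] at hx
  obtain ⟨c, hc, i, hi⟩ := Fintype.not_linearIndependent_iff.1 h3
  simp only [Fin.sum_univ_three, Matrix.cons_val_zero, Matrix.cons_val_one, Matrix.cons_val] at hc
  -- Otherwise the relation applied to `x` would be a dependence between `x` and `Ax`.
  have h2 : c 2 ≠ 0 := fun h2 => by
    have h1 := congrArg (fun M => Matrix.mulVec M x) hc
    simp only [h2, zero_smul, add_zero, Matrix.add_mulVec, Matrix.smul_mulVec, Matrix.one_mulVec,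
      Matrix.zero_mulVec] at h1
    obtain ⟨h4, h5⟩ := LinearIndependent.pair_iff.1 hx _ _ h1
    fin_cases i
    exacts [hi h4, hi h5, hi h2]
  have hA : A * A = (-(c 2)⁻¹ * c 1) • A + (-(c 2)⁻¹ * c 0) • 1 := by
    have h1 : c 2 • (A * A) = -(c 1 • A + c 0 • 1) := by
      rw [eq_neg_iff_add_eq_zero, ← hc]
      abel
    rw [← inv_smul_smul₀ h2 (A * A), h1, smul_neg, smul_add, smul_smul, smul_smul, neg_mul, neg_mul,
      neg_smul, neg_smul, neg_add]
  exact hm.trans (le_finrank_centralizer_of_quadratic hA hx)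

theorem exists_mem_ker_ker {V : Type*} [AddCommGroup V] [Module ℝ V] (C : Submodule ℝ V)
    [FiniteDimensional ℝ C] (hC : 3 ≤ Module.finrank ℝ C) (f g : V →ₗ[ℝ] ℝ) :
    ∃ v ∈ C, v ≠ 0 ∧ f v = 0 ∧ g v = 0 := by
  have h : LinearMap.ker ((f.prod g).comp C.subtype) ≠ ⊥ := by
    apply LinearMap.ker_ne_bot_of_finrank_lt
    simp
    omega
  obtain ⟨v, hv, hv0⟩ := Submodule.exists_mem_ne_zero_of_ne_bot h
  have hv' : (f v, g v) = 0 := hv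
  exact ⟨v, v.2, by simpa using hv0, congrArg Prod.fst hv', congrArg Prod.snd hv'⟩

/-! ### Left invariant forms -/

theorem contDiff_adjugate (m : ℕ) : ContDiff ℝ ∞ (Matrix.adjugate : Mat m → Mat m) := by
  have h : (Matrix.adjugate : Mat m → Mat m) = fun X => ∑ p : Fin m × Fin m,
      X.adjugate p.1 p.2 • Matrix.single p.1 p.2 (1 : ℝ) := by
    funext X
    exact eq_sum_single _
  rw [h]
  refine ContDiff.sum fun p _ => ContDiff.fun_smul ?_ contDiff_const
  simp_rw [Matrix.adjugate_apply, Matrix.det_apply']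
  refine ContDiff.sum fun s _ => contDiff_const.mul (contDiff_prod fun i _ => ?_)
  by_cases hi : s i = p.2
  · simp only [hi, Matrix.updateRow_self]
    exact contDiff_const
  · simp only [Matrix.updateRow_ne hi]
    exact (coord (s i) i).contDiff

/-- Matrix multiplication as a continuous bilinear map. -/
def mulL (m : ℕ) : Mat m →L[ℝ] Mat m →L[ℝ] Mat m :=
  LinearMap.toContinuousLinearMap
    { toFun := mulLeftL
      map_add' := fun A B => by ext1 V; exact add_mul A B V
      map_smul' := fun c A => by ext1 V; exact smul_mul_assoc c A V }

theorem mulL_apply {m : ℕ} (A V : Mat m) : mulL m A V = A * V := rfl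

/-- Differentiate adj(X) X = det(X)·1 at the identity. -/
theorem fderiv_adjugate_one {m : ℕ} {V : Mat m}
    (hV : fderiv ℝ (Matrix.det : Mat m → ℝ) 1 V = 0) :
    fderiv ℝ (Matrix.adjugate : Mat m → Mat m) 1 V = -V := by
  have hadj : HasFDerivAt (Matrix.adjugate : Mat m → Mat m) (fderiv ℝ Matrix.adjugate 1) 1 :=
    ((contDiff_adjugate m).differentiable (by simp) 1).hasFDerivAt
  have h1 := ((mulL m).hasFDerivAt.comp (1 : Mat m) hadj).clm_apply (hasFDerivAt_id (1 : Mat m))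
  have h2 := (differentiableAt_det (1 : Mat m)).hasFDerivAt.smul_const (1 : Mat m)
  have h3 : (fun X : Mat m => (mulL m ∘ Matrix.adjugate) X (id X)) = fun X => X.det • 1 := by
    funext X
    exact Matrix.adjugate_mul X
  rw [h3] at h1
  have h4 := congrArg (fun L => L V) (h1.unique h2)
  simp [mulL_apply, hV] at h4
  exact eq_neg_of_add_eq_zero_right h4

/-- The left invariant extension of a linear functional on the Lie algebra. -/
def leftInvariantExt {m : ℕ} (ξ : Mat m →L[ℝ] ℝ) (X : Mat m) : Mat m [⋀^Fin 1]→L[ℝ] ℝ :=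
  toForm m (ξ.comp (mulL m X.adjugate))

/-- The adjugate equals the inverse on SL but is polynomial, so the extension is smooth on all
matrices. -/
theorem contDiff_leftInvariantExt {m : ℕ} (ξ : Mat m →L[ℝ] ℝ) :
    ContDiff ℝ ∞ (leftInvariantExt ξ) :=
  (toForm m).contDiff.comp
    (contDiff_const.clm_comp ((mulL m).contDiff.comp (contDiff_adjugate m)))

/-- The Maurer–Cartan equation at the identity. -/
theorem extDeriv_leftInvariantExt_one {m : ℕ} (ξ : Mat m →L[ℝ] ℝ) {V W : Mat m}
    (hV : fderiv ℝ (Matrix.det : Mat m → ℝ) 1 V = 0)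
    (hW : fderiv ℝ (Matrix.det : Mat m → ℝ) 1 W = 0) :
    extDeriv (leftInvariantExt ξ) 1 ![V, W] = ξ (W * V) - ξ (V * W) := by
  have hadj : HasFDerivAt (Matrix.adjugate : Mat m → Mat m) (fderiv ℝ Matrix.adjugate 1) 1 :=
    ((contDiff_adjugate m).differentiable (by simp) 1).hasFDerivAt
  have h := (hasFDerivAt_const ξ (1 : Mat m)).clm_comp
    ((mulL m).hasFDerivAt.comp (1 : Mat m) hadj)
  refine (extDeriv_toForm h ![V, W]).trans ?_
  simp [mulL_apply, fderiv_adjugate_one hV, fderiv_adjugate_one hW]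
  ring

theorem isLocalExtension_leftInvariantExt {m : ℕ} {α : Form m 1} (hα : IsLeftInvariant α)
    (ξ : Mat m →L[ℝ] ℝ) (hξ : ∀ W : tangentSpace (1 : SL m), α 1 (fun _ => W) = ξ W) (g : SL m) :
    IsLocalExtension α g (leftInvariantExt ξ) := by
  refine ⟨Set.univ, isOpen_univ, trivial, (contDiff_leftInvariantExt ξ).contDiffOn, fun h _ => ?_⟩
  -- Stated for general `k` because `h⁻¹ * h` is 1 only propositionally and the tangent space
  -- depends on it.
  have key : ∀ k : SL m, k = 1 → ∀ W : tangentSpace k, α k (fun _ => W) = ξ W := by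
    rintro k rfl W
    exact hξ W
  ext v
  rw [← hα h⁻¹ trivial h v]
  rw [show (fun i => leftTranslation h⁻¹ h (v i)) = fun _ => leftTranslation h⁻¹ h (v 0) by
    funext i
    rw [Subsingleton.elim i 0], key _ (inv_mul_cancel h)]
  change ξ (((h⁻¹ : SL m) : Mat m) * (v 0 : Mat m)) = ξ ((h : Mat m).adjugate * (v 0 : Mat m))
  rw [Matrix.SpecialLinearGroup.coe_inv]

theorem exists_eq_trace_mul {m : ℕ} (ξ : Mat m →L[ℝ] ℝ) :
    ∃ A : Mat m, ∀ V, ξ V = (A * V).trace := by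
  refine ⟨Matrix.of fun i j => ξ (Matrix.single j i 1), fun V => ?_⟩
  conv_lhs => rw [eq_sum_single V]
  rw [map_sum, Fintype.sum_prod_type, Finset.sum_comm, Matrix.trace]
  refine Finset.sum_congr rfl fun i _ => ?_
  rw [Matrix.diag_apply, Matrix.mul_apply]
  refine Finset.sum_congr rfl fun j _ => ?_
  rw [map_smul, smul_eq_mul, mul_comm]
  rfl

theorem not_isContactForm_of_isLeftInvariant {m : ℕ} (hm : 3 ≤ m) {α : Form m 1}
    (hα : IsLeftInvariant α) : ¬ IsContactForm α := by
  rintro ⟨-, p, hp⟩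
  obtain ⟨hp1, hp2⟩ := hp 1
  let ξ₀ : tangentSpace (1 : SL m) →ₗ[ℝ] ℝ :=
    ((ContinuousAlternatingMap.ofSubsingleton ℝ _ ℝ (0 : Fin 1)).symm (α 1)).toLinearMap
  -- Any linear extension from trace-zero matrices to all matrices will do.
  obtain ⟨ξ₁, hξ₁⟩ := LinearMap.exists_extend ξ₀
  let ξ : Mat m →L[ℝ] ℝ := LinearMap.toContinuousLinearMap ξ₁
  have hξ : ∀ W : tangentSpace (1 : SL m), α 1 (fun _ => W) = ξ W := fun W =>
    (congrArg (fun L => L W) hξ₁).symm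
  obtain ⟨A, hA⟩ := exists_eq_trace_mul ξ
  obtain ⟨V, hVA, hV0, hVdet, hVξ⟩ := exists_mem_ker_ker (centralizer A)
    (three_le_finrank_centralizer hm A) (fderiv ℝ (Matrix.det : Mat m → ℝ) 1).toLinearMap ξ₁
  rw [mem_centralizer] at hVA
  have hVt : V ∈ tangentSpace (1 : SL m) := hVdet
  have hmem : (⟨V, hVt⟩ : tangentSpace (1 : SL m)) ∈ characteristicSpace α 1 := by
    rw [mem_characteristicSpace_iff, d_eq (isLocalExtension_leftInvariantExt hα ξ hξ 1), hξ]
    refine ⟨hVξ, fun W => ?_⟩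
    have h1 := extDeriv_leftInvariantExt_one ξ hVdet W.2
    -- Since AV = VA, cyclicity of the trace gives tr(AVW) = tr(AWV).
    have h2 : ξ (W * V) - ξ (V * W) = 0 := by
      rw [hA, hA, ← mul_assoc A V, hVA, mul_assoc V, Matrix.trace_mul_comm V, mul_assoc, sub_self]
    rw [h2] at h1
    rw [← h1, pullback, ContinuousAlternatingMap.compContinuousLinearMap_apply]
    congr 1
    ext i
    fin_cases i <;> rfl
  -- A class equal to the dimension leaves no characteristic vector, against the `V` just found.
  have hbot : characteristicSpace α 1 = ⊥ := by
    apply Submodule.finrank_eq_zero.1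
    have := (characteristicSpace α 1).finrank_quotient_add_finrank
    rw [cartanClass] at hp2
    omega
  rw [hbot, Submodule.mem_bot] at hmem
  exact hV0 (congrArg Subtype.val hmem)

end SLForms

end

theorem mainTheorem2 (n : ℕ) (hn : 1 ≤ n) :
    -- `ω` is a contact form on `SL(2n, ℝ)`
    SLForms.IsContactForm (SLForms.omega n) ∧
    -- `ω̃ ∧ (dω̃)^(2n² - 1) ∧ dΔ` is a nonzero constant multiple of `Δ · vol`
    (∃ c : ℝ, c ≠ 0 ∧ ∀ X : SLForms.Mat (2 * n),
      SLForms.toExtAlg (SLForms.omegaTilde n X) *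
          SLForms.toExtAlg (extDeriv (SLForms.omegaTilde n) X) ^ (2 * n ^ 2 - 1) *
          SLForms.toExtAlg (SLForms.dDet (2 * n) X) =
        (c * X.det) • SLForms.volForm (2 * n)) ∧
    -- `ω` is invariant under `SO(2n, ℝ)`
    SLForms.IsInvariantUnder (SLForms.SO (2 * n)) (SLForms.omega n) ∧
    -- `SO(2n, ℝ)` is a maximal compact subgroup of `SL(2n, ℝ)`
    (IsCompact (SLForms.SO (2 * n) : Set (SLForms.SL (2 * n))) ∧
      ∀ K : Subgroup (SLForms.SL (2 * n)), IsCompact (K : Set (SLForms.SL (2 * n))) →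
        SLForms.SO (2 * n) ≤ K → K = SLForms.SO (2 * n)) ∧
    -- for `n ≥ 2` no left invariant Pfaffian form is a contact form
    (2 ≤ n → ∀ α : SLForms.Form (2 * n) 1,
      SLForms.IsLeftInvariant α → ¬ SLForms.IsContactForm α) :=
  ⟨SLForms.isContactForm_omega hn, SLForms.omegaTilde_wedge_identity hn,
    SLForms.isInvariantUnder_SO_omega n,
    ⟨SLForms.isCompact_SO (2 * n), fun K hK hle => SLForms.eq_SO_of_isCompact K hK hle⟩,
    fun h2 _ hα => SLForms.not_isContactForm_of_isLeftInvariant (by omega) hα⟩
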